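/- **Setting.** Let $n\ge 1$, $N=\{1,\dots,n\}$, $m=2^n-1$; vectors in $\mathbb R^m$ are indexed by the nonempty coalitions $S\subseteq N$, vectors in $\mathbb R^{m-1}$ by those with $S\ne N$. Let $(v(t))_{t\ge 0}$ be a jointly measurable $\mathbb R^m$-valued process on a probability space which is bounded and mean ergodic: there are a bounded convex set $\mathcal V\subset\mathbb R^m$ and a probability measure $\mathbb P$ with $\mathbb P(\mathcal V)=1$ such that every $v(t)$, $t\ge 0$, has law $\mathbb P$; and there is a vector $v_{nom}$ with $\mathbb E[v(t)]=v_{nom}$ for all $t\ge 0$ and $\bar v(\tau)=\frac1\tau\int_0^\tau v(s)\,ds\to v_{nom}$ as $\tau\to\infty$ with probability one. Put $\Delta v(t)=v(t)-v_{nom}$. Let $a_{nom}\in\mathbb R^n$ be in the core of $v_{nom}$, that is, $\sum_{i\in N}a_{nom,i}=v_{nom,N}$ and $\sum_{i\in S}a_{nom,i}\ge v_{nom,S}$ for every nonempty $S$. Let $s_{nom}\in\mathbb R^{m-1}$, $s_{nom,S}=\sum_{i\in S}a_{nom,i}-v_{nom,S}$, and $u_{nom}=(a_{nom},s_{nom})\in\mathbb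 R^{n+m-1}$. Let $B=\left[B_{\mathcal H}\;\Big|\;\begin{smallmatrix}-I_{m-1}\\0\end{smallmatrix}\right]\in\mathbb R^{m\times(n+m-1)}$, where the rows of $B_{\mathcal H}$ are the characteristic vectors of the nonempty coalitions (last row: $N$), so that $Bu_{nom}=v_{nom}$. Given $a_{min},a_{max}\in\mathbb R^n$, the set of feasible controls is $U=\{(a,s): a_{min}\le a\le a_{max},\ s\ge 0\}\subset\mathbb R^{n}\times\mathbb R^{m-1}$. For each component $j$, let $\Delta u^{min}_j$ and $\Delta u^{max}_j$ be the infimum and supremum in $[-\infty,\infty]$ of $\Delta u_j$ over all $\Delta u$ with $u_{nom}+\Delta u\in U$; assume $\Delta u^{min}_j<0<\Delta u^{max}_j$ for every $j$. Let $\mathrm{sat}_{[a,b]}(\xi)$ be the componentwise truncation of $\xi$ to $[a_i,b_i]$ (no truncation at an infinite bound). Let $B^\dagger,C,F$ be any real matrices with $\begin{bmatrix}B\\C\end{bmatrix}\begin{bmatrix}B^\dagger&F\end{bmatrix}=I$ (sizes $(n+m-1)\times m$, $(n-1)\times(n+m-1)$, $(n+m-1)\times(n-1)$). Let $x(t)\in\mathbb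 R^m$ and $y(t)\in\mathbb R^{n-1}$ be random processes with square integrable initial values $x(0),y(0)$ which with probability one satisfy, in the sense of Carathéodory on $[0,\infty)$, $$\dot x(t)=B\,\Delta u(t)-\Delta v(t),\qquad \dot y(t)=C\,\Delta u(t),$$ where $z(t)=B^\dagger x(t)+Fy(t)$ (so that $\dot z(t)=\Delta u(t)-B^\dagger\Delta v(t)$), with the saturated feedback $$u(t)=u_{nom}+\Delta u(t),\qquad \Delta u(t)=\mathrm{sat}_{[\Delta u^{min},\Delta u^{max}]}(-z(t)).$$ Assume that for every $t\ge 0$ the vector $x(t)$ is independent of $\Delta v(t)$ and the vector $y(t)$ is independent of $v(t)$. **Theorem.** With probability one $\lim_{t\to\infty}z(t)=0$, and with probability one $\lim_{t\to\infty}\bar u(t)=u_{nom}$, where $\bar u(t)=\frac1t\int_0^t u(s)\,ds$. -/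

import Mathlib

open MeasureTheory ProbabilityTheory Filter Topology

noncomputable section

namespace DynamicTU

/-- The nonempty coalitions of the player set `{1, …, n}`; there are `m = 2 ^ n - 1` of them. -/
abbrev Coalition (n : ℕ) : Type := {S : Finset (Fin n) // S.Nonempty}

/-- The `m - 1` nonempty coalitions other than the grand coalition. -/
abbrev ProperCoalition (n : ℕ) : Type := {S : Coalition n // S.1 ≠ Finset.univ}

/-- Index type of the `n + m - 1` control components: an allocation component for every player and
a surplus component for every nonempty coalition other than the grand coalition. -/
abbrev ControlIdx (n : ℕ) : Type := Fin n ⊕ ProperCoalition n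

/-- The grand coalition. -/
def grand (n : ℕ) [NeZero n] : Coalition n := ⟨Finset.univ, Finset.univ_nonempty⟩

/-- The core of the transferable utility game with characteristic function `η`. -/
def core {n : ℕ} [NeZero n] (η : Coalition n → ℝ) : Set (Fin n → ℝ) :=
  {a | ∑ i, a i = η (grand n) ∧ ∀ S : Coalition n, η S ≤ ∑ i ∈ S.1, a i}

/-- The incidence matrix of the hypergraph: its rows are the characteristic vectors. -/
def incidence (n : ℕ) : Matrix (Coalition n) (Fin n) ℝ :=
  Matrix.of fun S i => if i ∈ S.1 then 1 else 0

/-- The surplus block: minus the identity on the proper coalitions, above a zero row for the grand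
coalition. -/
def surplusBlock (n : ℕ) : Matrix (Coalition n) (ProperCoalition n) ℝ :=
  Matrix.of fun S T => if S = T.1 then -1 else 0

/-- The `m × (n + m - 1)` matrix `B` of the flow dynamics `x' = B u - v`. -/
def flowMatrix (n : ℕ) : Matrix (Coalition n) (ControlIdx n) ℝ :=
  Matrix.fromCols (incidence n) (surplusBlock n)

/-- The set `U` of feasible controls `(a, s)`: `a` in the box `[aMin, aMax]` and `s ≥ 0`. -/
def feasibleControls {n : ℕ} (aMin aMax : Fin n → ℝ) : Set (ControlIdx n → ℝ) :=
  {u | (∀ i, aMin i ≤ u (Sum.inl i) ∧ u (Sum.inl i) ≤ aMax i) ∧ ∀ S, 0 ≤ u (Sum.inr S)}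

/-- The nominal control `uNom = (aNom, sNom)`, where `sNom` is the surplus that `aNom` leaves over
the values `vNom`. -/
def nominalControl {n : ℕ} (aNom : Fin n → ℝ) (vNom : Coalition n → ℝ) : ControlIdx n → ℝ :=
  Sum.elim aNom fun S => ∑ i ∈ S.1.1, aNom i - vNom S.1

/-- The componentwise minimal value of `Δu` subject to `uNom + Δu ∈ U`. -/
def deltaMin {ι : Type*} (U : Set (ι → ℝ)) (uNom : ι → ℝ) (j : ι) : EReal :=
  sInf {r : EReal | ∃ Δu : ι → ℝ, uNom + Δu ∈ U ∧ r = (Δu j : EReal)}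

/-- The componentwise maximal value of `Δu` subject to `uNom + Δu ∈ U`; it is `⊤` in the directions
in which `U` is unbounded above, where there is no upper saturation. -/
def deltaMax {ι : Type*} (U : Set (ι → ℝ)) (uNom : ι → ℝ) (j : ι) : EReal :=
  sSup {r : EReal | ∃ Δu : ι → ℝ, uNom + Δu ∈ U ∧ r = (Δu j : EReal)}

open scoped Classical in
/-- The componentwise saturation of `ξ` between the bounds `a` and `b`, which may be infinite. -/
def sat {ι : Type*} (a b : ι → EReal) (ξ : ι → ℝ) : ι → ℝ := fun i =>
  if b i < (ξ i : EReal) then (b i).toReal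
  else if (ξ i : EReal) < a i then (a i).toReal
  else ξ i

/-- The saturated feedback `φ z = uNom + sat (-z)`. -/
def feedback {ι : Type*} (U : Set (ι → ℝ)) (uNom : ι → ℝ) (z : ι → ℝ) : ι → ℝ :=
  uNom + sat (deltaMin U uNom) (deltaMax U uNom) (-z)

/-- The average `(1 / t) ∫₀ᵗ f` of a trajectory up to time `t`. -/
def timeAverage {ι : Type*} [Fintype ι] (f : ℝ → ι → ℝ) (t : ℝ) : ι → ℝ :=
  t⁻¹ • ∫ s in (0 : ℝ)..t, f s

/-- `X` solves `X' = f` on `[0, ∞)` in the sense of Carathéodory (`X` is an indefinite integral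
of `f`). -/
def IsTrajectory {ι : Type*} [Fintype ι] (f X : ℝ → ι → ℝ) : Prop :=
  ∀ t : ℝ, 0 ≤ t → IntervalIntegrable f volume 0 t ∧ X t = X 0 + ∫ s in (0 : ℝ)..t, f s

/-- `v` is a bounded mean ergodic process with values in the bounded convex set `𝒱`, one-time law
`P` and long-run average `vNom`. -/
structure IsBoundedMeanErgodic {ι Ω : Type*} [Fintype ι] [MeasurableSpace Ω] (μ : Measure Ω)
    (𝒱 : Set (ι → ℝ)) (P : Measure (ι → ℝ)) (v : ℝ → Ω → ι → ℝ) (vNom : ι → ℝ) : Prop where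
  measurable : Measurable (Function.uncurry v)
  convex : Convex ℝ 𝒱
  bounded : Bornology.IsBounded 𝒱
  mem : ∀ᵐ w ∂P, w ∈ 𝒱
  law : ∀ t : ℝ, 0 ≤ t → μ.map (v t) = P
  mean : ∀ t : ℝ, 0 ≤ t → ∫ ω, v t ω ∂μ = vNom
  ergodic : ∀ᵐ ω ∂μ, Tendsto (timeAverage fun s => v s ω) atTop (𝓝 vNom)

/-- The augmented variable `z = B† x + F y`. -/
def augmented {n : ℕ} (Bd : Matrix (ControlIdx n) (Coalition n) ℝ)
    (F : Matrix (ControlIdx n) (Fin (n - 1)) ℝ) (x : Coalition n → ℝ) (y : Fin (n - 1) → ℝ) :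
    ControlIdx n → ℝ :=
  (Matrix.fromCols Bd F).mulVec (Sum.elim x y)

end DynamicTU

end

open DynamicTU

/-! The stacked matrix of `B` and `C` is square, so its right inverse is also a left inverse and
`B†B + FC = I`. The dynamics of `z` therefore decouple into scalar equations `z_j' = -g_j(z_j) -
w_j`, where `g_j(ξ) = -sat(-ξ)` has the sign of `ξ` and `w_j = (B†Δv)_j` is bounded with mean zero
at each time.

The energy `z_j² / 2` has derivative `-z_j g_j(z_j) - z_j w_j`. Independence gives `E[z_j w_j] = 0`
at each time, so the expected dissipation `E ∫₀ᵗ z_j g_j(z_j)` is at most `E[z_j(0)²] / 2` for every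
`t` (`lintegral_dissipation_le`). Monotone convergence makes the dissipation over `[0, ∞)` finite
almost surely. Since `|z_j|` grows at a bounded rate and `ξ g_j(ξ)` is bounded below away from zero,
a Barbalat argument (`tendsto_zero_of_integrableOn_of_abs_le_add`) forces `z_j → 0`. Then `u = uNom
- g(z)` tends to `uNom`, and so do its running averages. -/

/-- `X` is an indefinite integral of the real function `h` on `[0, ∞)`. -/
def IsPrimitive (h X : ℝ → ℝ) : Prop :=
  ∀ t : ℝ, 0 ≤ t → IntervalIntegrable h volume 0 t ∧ X t = X 0 + ∫ s in (0 : ℝ)..t, h s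

/-! ### Growth and energy of indefinite integrals -/

namespace IsPrimitive

variable {h X : ℝ → ℝ}

theorem intervalIntegrable (hX : IsPrimitive h X) {s t : ℝ} (hs : 0 ≤ s) (ht : 0 ≤ t) :
    IntervalIntegrable h volume s t :=
  (hX s hs).1.symm.trans (hX t ht).1

theorem sub_eq (hX : IsPrimitive h X) {s t : ℝ} (hs : 0 ≤ s) (ht : 0 ≤ t) :
    X t - X s = ∫ r in s..t, h r := by
  rw [(hX t ht).2, (hX s hs).2,
    ← intervalIntegral.integral_interval_sub_left (hX t ht).1 (hX s hs).1]
  ring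

theorem neg (hX : IsPrimitive h X) : IsPrimitive (fun t => -h t) (fun t => -X t) := fun t ht =>
  ⟨(hX t ht).1.neg, by
    have := (hX t ht).2
    simp only [intervalIntegral.integral_neg]
    linarith⟩

theorem continuousOn_Icc (hX : IsPrimitive h X) (t : ℝ) : ContinuousOn X (Set.Icc 0 t) := by
  rcases lt_or_ge t 0 with ht | ht
  · simp [Set.Icc_eq_empty_of_lt ht]
  · have hc : ContinuousOn (fun s => X 0 + ∫ r in (0 : ℝ)..s, h r) (Set.uIcc 0 t) :=
      continuousOn_const.add (intervalIntegral.continuousOn_primitive_interval'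
        (hX t ht).1 Set.left_mem_uIcc)
    rw [Set.uIcc_of_le ht] at hc
    exact hc.congr fun s hs => (hX s hs.1).2

theorem continuousOn_Ici (hX : IsPrimitive h X) : ContinuousOn X (Set.Ici 0) := by
  intro s hs
  have hs0 : (0 : ℝ) ≤ s := hs
  refine ((hX.continuousOn_Icc (s + 1)) s ⟨hs, by linarith⟩).mono_of_mem_nhdsWithin ?_
  rw [← Set.Ici_inter_Iic]
  exact Filter.inter_mem self_mem_nhdsWithin
    (mem_nhdsWithin_of_mem_nhds (Iic_mem_nhds (by linarith)))

/-- Freezing the path before time zero makes it continuous on the whole line, the form in which it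
yields joint measurability later. -/
theorem continuous_comp_max (hX : IsPrimitive h X) : Continuous fun t => X (max t 0) :=
  hX.continuousOn_Ici.comp_continuous (by fun_prop) fun t => le_max_right t 0

/-- If the derivative is at most `K` where the function is positive, the positive part grows at
rate at most `K`. -/
theorem le_max_add (hX : IsPrimitive h X) {K : ℝ} (hK : 0 ≤ K)
    (hh : ∀ᵐ r, 0 ≤ r → 0 < X r → h r ≤ K) {s t : ℝ} (hs : 0 ≤ s) (hst : s ≤ t) :
    X t ≤ max (X s) 0 + K * (t - s) := by
  set c := max (X s) 0 with hc
  -- The supremum of `A` is the last time in `[s, t]` at which `X ≤ c`. After it `X > c ≥ 0`, so the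
  -- rate bound applies up to `t`.
  let A : Set ℝ := Set.Icc s t ∩ X ⁻¹' Set.Iic c
  have hcont : ContinuousOn X (Set.Icc s t) :=
    (hX.continuousOn_Icc t).mono (Set.Icc_subset_Icc_left hs)
  have hA : IsClosed A := hcont.preimage_isClosed_of_isClosed isClosed_Icc isClosed_Iic
  have hsA : s ∈ A := ⟨⟨le_rfl, hst⟩, le_max_left (X s) 0⟩
  have hbdd : BddAbove A := ⟨t, fun r hr => hr.1.2⟩
  have hr := hA.csSup_mem ⟨s, hsA⟩ hbdd
  set r := sSup A
  have hr0 : 0 ≤ r := hs.trans hr.1.1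
  have hpos : ∀ q, r < q → q ≤ t → c < X q := by
    intro q hq hqt
    by_contra! hcon
    exact (not_lt.mpr (le_csSup hbdd ⟨⟨hr.1.1.trans hq.le, hqt⟩, hcon⟩)) hq
  have hint : ∫ q in r..t, h q ≤ ∫ _ in r..t, K := by
    apply intervalIntegral.integral_mono_ae_restrict hr.1.2
      (hX.intervalIntegrable hr0 (hs.trans hst)) intervalIntegrable_const
    rw [← MeasureTheory.restrict_Ioc_eq_restrict_Icc, EventuallyLE,
      ae_restrict_iff' measurableSet_Ioc]
    filter_upwards [hh] with q hq hqm
    exact hq (hr0.trans hqm.1.le) ((le_max_right _ _).trans_lt (hpos q hqm.1 hqm.2))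
  rw [← hX.sub_eq hr0 (hs.trans hst), intervalIntegral.integral_const, smul_eq_mul] at hint
  have h1 : X r ≤ c := hr.2
  nlinarith [hr.1.1]


theorem abs_le_abs_add (hX : IsPrimitive h X) {K : ℝ} (hK : 0 ≤ K)
    (hpos : ∀ᵐ r, 0 ≤ r → 0 < X r → h r ≤ K) (hneg : ∀ᵐ r, 0 ≤ r → X r < 0 → -K ≤ h r)
    {s t : ℝ} (hs : 0 ≤ s) (hst : s ≤ t) : |X t| ≤ |X s| + K * (t - s) := by
  have h1 := hX.le_max_add hK hpos hs hst
  have h2 := hX.neg.le_max_add hK (by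
    filter_upwards [hneg] with r hr h0 h1
    linarith [hr h0 (by linarith)]) hs hst
  have h3 : max (X s) 0 ≤ |X s| := max_le (le_abs_self _) (abs_nonneg _)
  have h4 : max (-X s) 0 ≤ |X s| := max_le (neg_le_abs _) (abs_nonneg _)
  exact abs_le'.mpr ⟨by linarith, by linarith⟩

/-- Fundamental theorem of calculus for the square of an absolutely continuous function. -/
theorem sq_eq (hX : IsPrimitive h X) {t : ℝ} (ht : 0 ≤ t) :
    X t ^ 2 = X 0 ^ 2 + 2 * ∫ s in (0 : ℝ)..t, X s * h s := by
  -- Integration by parts is applied to `Y` with itself, where `Y' = h` almost everywhere; the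
  -- constant `X 0` is restored in `e3`.
  let Y : ℝ → ℝ := fun s => ∫ r in (0 : ℝ)..s, h r
  have hYac : AbsolutelyContinuousOnInterval Y 0 t :=
    (hX t ht).1.absolutelyContinuousOnInterval_intervalIntegral Set.left_mem_uIcc
  have hparts := hYac.integral_mul_deriv_eq_deriv_mul hYac
  have hder : ∀ᵐ s, s ∈ Set.uIoc 0 t → deriv Y s = h s := by
    filter_upwards [(hX t ht).1.ae_hasDerivAt_integral] with s hs hst
    exact (hs (Set.uIoc_subset_uIcc hst) 0 Set.left_mem_uIcc).deriv
  have e1 : ∫ s in (0 : ℝ)..t, Y s * deriv Y s = ∫ s in (0 : ℝ)..t, Y s * h s :=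
    intervalIntegral.integral_congr_ae (hder.mono fun s hs hst => by rw [hs hst])
  have e2 : ∫ s in (0 : ℝ)..t, deriv Y s * Y s = ∫ s in (0 : ℝ)..t, Y s * h s :=
    intervalIntegral.integral_congr_ae (hder.mono fun s hs hst => by rw [hs hst, mul_comm])
  have e3 : ∫ s in (0 : ℝ)..t, X s * h s
      = X 0 * (∫ s in (0 : ℝ)..t, h s) + ∫ s in (0 : ℝ)..t, Y s * h s := by
    rw [← intervalIntegral.integral_const_mul, ← intervalIntegral.integral_add
      ((hX t ht).1.const_mul _) ((hX t ht).1.continuousOn_mul hYac.continuousOn)]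
    refine intervalIntegral.integral_congr fun s hs => ?_
    rw [Set.uIcc_of_le ht] at hs
    simp only [(hX s hs.1).2, Y]
    ring
  have e4 : Y 0 = 0 := by simp [Y]
  rw [e1, e2, e4] at hparts
  have e5 : X t = X 0 + Y t := (hX t ht).2
  have e6 : (∫ s in (0 : ℝ)..t, h s) = Y t := rfl
  rw [e3, e5, e6]
  linear_combination -hparts

end IsPrimitive

/-! ### Deterministic limits at infinity -/

/-- A version of Barbalat's lemma: if the absolute value of `X` grows at a bounded rate and a
coercive function of `X` is integrable, then `X` vanishes at infinity. -/
theorem tendsto_zero_of_integrableOn_of_abs_le_add {X ψ : ℝ → ℝ} {K : ℝ} (hK : 0 ≤ K)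
    (hX : ∀ s t, 0 ≤ s → s ≤ t → |X t| ≤ |X s| + K * (t - s))
    (hψ : ∀ δ > 0, ∃ η > 0, ∀ x, δ ≤ |x| → η ≤ ψ x)
    (hint : IntegrableOn (fun s => ψ (X s)) (Set.Ioi 0)) :
    Tendsto X atTop (𝓝 0) := by
  rw [Metric.tendsto_atTop]
  intro δ hδ
  obtain ⟨η, hη, hηψ⟩ := hψ (δ / 2) (by positivity)
  -- A rise in `|X|` is limited but a fall is not, so the window looks backwards: `|X t| ≥ δ` forces
  -- `|X| ≥ δ / 2` on `[t - l, t]`, which contributes at least `l * η` to the integral. The `+ 1`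
  -- covers `K = 0`.
  set l := δ / (2 * (K + 1)) with hl
  have hl0 : 0 < l := by positivity
  have hKl : K * l ≤ δ / 2 := by
    rw [hl, ← mul_div_assoc, div_le_div_iff₀ (by positivity) (by positivity)]
    nlinarith
  have hlim := intervalIntegral_tendsto_integral_Ioi 0 hint tendsto_id
  have hlim2 := hlim.comp (tendsto_atTop_add_const_right atTop (-l) tendsto_id)
  have hdiff := hlim.sub hlim2
  rw [sub_self] at hdiff
  obtain ⟨T, hT⟩ := eventually_atTop.mp (hdiff.eventually_lt_const (show 0 < l * η by positivity))
  refine ⟨max T l, fun t ht => ?_⟩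
  have hlt : l ≤ t := (le_max_right _ _).trans ht
  have h1 := hT t ((le_max_left _ _).trans ht)
  rw [dist_zero_right, Real.norm_eq_abs]
  by_contra! hcon
  have hii : ∀ a, 0 ≤ a → IntervalIntegrable (fun s => ψ (X s)) volume 0 a := fun a ha =>
    (intervalIntegrable_iff_integrableOn_Ioc_of_le ha).mpr (hint.mono_set Set.Ioc_subset_Ioi_self)
  simp only [id, Function.comp] at h1
  rw [intervalIntegral.integral_interval_sub_left (hii _ (by linarith)) (hii _ (by linarith))] at h1
  have h2 : ∫ _ in (t + -l)..t, η ≤ ∫ s in (t + -l)..t, ψ (X s) := by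
    apply intervalIntegral.integral_mono_on (by linarith) intervalIntegrable_const
      ((hii _ (by linarith)).symm.trans (hii _ (by linarith)))
    intro s hs
    apply hηψ
    have := hX s t (by linarith [hs.1]) hs.2
    nlinarith [hs.1]
  rw [intervalIntegral.integral_const, smul_eq_mul] at h2
  linarith [show t - (t + -l) = l by ring, congrArg (· * η) (show t - (t + -l) = l by ring)]

/-- Continuous-time Cesàro: the running average of a convergent function has the same limit. -/
theorem tendsto_inv_smul_integral {E : Type*} [NormedAddCommGroup E] [NormedSpace ℝ E]
    [CompleteSpace E] {f : ℝ → E} {L : E} (hint : ∀ t, 0 ≤ t → IntervalIntegrable f volume 0 t)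
    (hf : Tendsto f atTop (𝓝 L)) :
    Tendsto (fun t => t⁻¹ • ∫ s in (0 : ℝ)..t, f s) atTop (𝓝 L) := by
  rw [Metric.tendsto_atTop] at hf
  rw [tendsto_iff_norm_sub_tendsto_zero, Metric.tendsto_atTop]
  intro ε hε
  obtain ⟨T₀, hT₀⟩ := hf (ε / 2) (by positivity)
  set T := max T₀ 1
  have hT1 : 1 ≤ T := le_max_right _ _
  have hlim : Tendsto (fun t : ℝ => t⁻¹ * ‖∫ s in (0 : ℝ)..T, (f s - L)‖) atTop (𝓝 0) := by
    simpa using tendsto_inv_atTop_zero.mul_const ‖∫ s in (0 : ℝ)..T, (f s - L)‖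
  obtain ⟨M, hM⟩ := eventually_atTop.mp (hlim.eventually_lt_const (half_pos hε))
  refine ⟨max M T, fun t ht => ?_⟩
  have htT : T ≤ t := (le_max_right _ _).trans ht
  have ht0 : 0 < t := by linarith
  have hii : ∀ a, 0 ≤ a → IntervalIntegrable (fun s => f s - L) volume 0 a := fun a ha =>
    (hint a ha).sub intervalIntegrable_const
  have e : (t⁻¹ • ∫ s in (0 : ℝ)..t, f s) - L = t⁻¹ • ∫ s in (0 : ℝ)..t, (f s - L) := by
    rw [intervalIntegral.integral_sub (hint t ht0.le) intervalIntegrable_const,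
      intervalIntegral.integral_const, smul_sub, sub_zero, smul_smul, inv_mul_cancel₀ ht0.ne',
      one_smul]
  have hsplit := intervalIntegral.integral_add_adjacent_intervals (hii T (by linarith))
    ((hii T (by linarith)).symm.trans (hii t ht0.le))
  have htail : ‖∫ s in T..t, (f s - L)‖ ≤ ε / 2 * |t - T| :=
    intervalIntegral.norm_integral_le_of_norm_le_const fun s hs => by
      rw [Set.uIoc_of_le htT] at hs
      rw [← dist_eq_norm]
      exact (hT₀ s ((le_max_left _ _).trans hs.1.le)).le
  rw [abs_of_nonneg (by linarith)] at htail
  rw [dist_zero_right, norm_norm, e, ← hsplit, norm_smul, Real.norm_eq_abs,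
    abs_of_pos (inv_pos.mpr ht0)]
  calc t⁻¹ * ‖(∫ s in (0 : ℝ)..T, (f s - L)) + ∫ s in T..t, (f s - L)‖
      ≤ t⁻¹ * (‖∫ s in (0 : ℝ)..T, (f s - L)‖ + ε / 2 * (t - T)) := by
        gcongr
        exact (norm_add_le _ _).trans (by gcongr)
    _ < ε / 2 + t⁻¹ * (ε / 2 * t) := by
        rw [mul_add]
        refine add_lt_add_of_lt_of_le (hM t ((le_max_left _ _).trans ht)) ?_
        gcongr
        linarith
    _ = ε := by field_simp; ring

/-! ### Mean square dissipation and almost sure convergence -/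

section Dissipation

variable {Ω : Type*} [MeasurableSpace Ω] {μ : Measure Ω} [IsProbabilityMeasure μ]
  {f w : ℝ → Ω → ℝ} {g : ℝ → ℝ} {K : ℝ}

/-- A jointly measurable process that is bounded at every fixed time is, for almost every
sample, bounded at almost every time. -/
theorem ae_ae_of_forall_ae_abs_le (hw : Measurable (Function.uncurry w))
    (hwK : ∀ t, 0 ≤ t → ∀ᵐ ω ∂μ, |w t ω| ≤ K) :
    ∀ᵐ ω ∂μ, ∀ᵐ t : ℝ, 0 ≤ t → |w t ω| ≤ K := by
  have hm : MeasurableSet {p : ℝ × Ω | 0 ≤ p.1 → |w p.1 p.2| ≤ K} := by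
    have h1 : MeasurableSet {p : ℝ × Ω | 0 ≤ p.1} := measurableSet_le measurable_const measurable_fst
    have h2 : MeasurableSet {p : ℝ × Ω | |w p.1 p.2| ≤ K} :=
      measurableSet_le (hw.abs) measurable_const
    exact h1.imp h2
  refine (Measure.ae_ae_comm hm).mp (Eventually.of_forall fun t => ?_)
  by_cases ht : 0 ≤ t
  · filter_upwards [hwK t ht] with ω h _ using h
  · exact Eventually.of_forall fun ω h => absurd h ht

/-- Under a sign-preserving negative feedback and a bounded disturbance, the absolute value of the
state grows at a bounded rate. -/
theorem ae_abs_le_abs_add (hw : Measurable (Function.uncurry w)) (hK : 0 ≤ K)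
    (hgn : ∀ x, 0 ≤ x * g x)
    (htraj : ∀ᵐ ω ∂μ, IsPrimitive (fun t => -g (f t ω) - w t ω) (fun t => f t ω))
    (hwK : ∀ t, 0 ≤ t → ∀ᵐ ω ∂μ, |w t ω| ≤ K) :
    ∀ᵐ ω ∂μ, ∀ s t, 0 ≤ s → s ≤ t → |f t ω| ≤ |f s ω| + K * (t - s) := by
  filter_upwards [htraj, ae_ae_of_forall_ae_abs_le hw hwK] with ω h1 h2 s t hs hst
  refine h1.abs_le_abs_add hK ?_ ?_ hs hst
  · filter_upwards [h2] with r hr hr0 hpos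
    have := nonneg_of_mul_nonneg_right (hgn (f r ω)) hpos
    linarith [(abs_le.mp (hr hr0)).1]
  · filter_upwards [h2] with r hr hr0 hneg
    have := nonpos_of_mul_nonneg_right (hgn (f r ω)) hneg
    linarith [(abs_le.mp (hr hr0)).2]

theorem integrable_of_ae_abs_le_add {X Y : Ω → ℝ} {c : ℝ} (hX : AEStronglyMeasurable X μ)
    (hY : Integrable Y μ) (h : ∀ᵐ ω ∂μ, |X ω| ≤ |Y ω| + c) : Integrable X μ :=
  (hY.abs.add (integrable_const c)).mono' hX (by simpa using h)

/-- Mean square energy estimate: a process that follows a bounded disturbance uncorrelated with the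
current state, with a sign-preserving negative feedback `g` at most linear, dissipates at most its
initial energy. -/
theorem lintegral_dissipation_le (hf : Measurable (Function.uncurry f))
    (hw : Measurable (Function.uncurry w)) (hg : Measurable g) (hK : 0 ≤ K)
    (hgn : ∀ x, 0 ≤ x * g x) (hgl : ∀ x, |g x| ≤ |x|)
    (htraj : ∀ᵐ ω ∂μ, IsPrimitive (fun t => -g (f t ω) - w t ω) (fun t => f t ω))
    (hwK : ∀ t, 0 ≤ t → ∀ᵐ ω ∂μ, |w t ω| ≤ K) (h0 : MemLp (f 0) 2 μ)
    (hcorr : ∀ t, 0 ≤ t → ∫ ω, f t ω * w t ω ∂μ = 0) {t : ℝ} (ht : 0 ≤ t) :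
    ∫⁻ ω, (∫⁻ s in Set.Ioc 0 t, ENNReal.ofReal (f s ω * g (f s ω))) ∂μ
      ≤ ENNReal.ofReal (∫ ω, f 0 ω ^ 2 / 2 ∂μ) := by
  have hgrow := ae_abs_le_abs_add hw hK hgn htraj hwK
  have hwae := ae_ae_of_forall_ae_abs_le hw hwK
  have hf0 : Integrable (f 0) μ := h0.integrable (by norm_num)
  have hqm : Measurable fun p : Ω × ℝ => f p.2 p.1 * w p.2 p.1 :=
    (hf.mul hw).comp measurable_swap
  have hf0m : Measurable (f 0) := hf.comp measurable_prodMk_left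
  have hq : Integrable (fun p : Ω × ℝ => f p.2 p.1 * w p.2 p.1)
      (μ.prod (volume.restrict (Set.Ioc 0 t))) := by
    -- On `(0, t]` the growth bound gives `|f s| ≤ |f 0| + K t`, an integrable majorant that
    -- justifies Fubini for `f * w`.
    have hbd : Integrable (fun p : Ω × ℝ => (|f 0 p.1| + K * t) * K)
        (μ.prod (volume.restrict (Set.Ioc 0 t))) :=
      ((hf0.abs.add (integrable_const (K * t))).mul_const K).comp_fst _
    refine hbd.mono' hqm.aestronglyMeasurable ?_
    refine (Measure.ae_prod_iff_ae_ae ?_).mpr ?_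
    · exact measurableSet_le hqm.norm
        (((hf0m.abs.add_const _).mul_const _).comp measurable_fst)
    · filter_upwards [hgrow, hwae] with ω h1 h2
      rw [ae_restrict_iff' measurableSet_Ioc]
      filter_upwards [h2] with s hs hst
      have h3 := h1 0 s le_rfl hst.1.le
      rw [Real.norm_eq_abs, abs_mul]
      refine mul_le_mul (h3.trans ?_) (hs hst.1.le) (abs_nonneg _) (by positivity)
      have := mul_le_mul_of_nonneg_left hst.2 hK
      linarith
  have hJ : Integrable (fun ω => ∫ s in Set.Ioc 0 t, f s ω * w s ω) μ := hq.integral_prod_left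
  have hJ0 : ∫ ω, (∫ s in Set.Ioc 0 t, f s ω * w s ω) ∂μ = 0 := by
    rw [integral_integral_swap hq]
    refine (setIntegral_congr_fun measurableSet_Ioc fun s hs => hcorr s hs.1.le).trans ?_
    simp
  have hsq : Integrable (fun ω => f 0 ω ^ 2 / 2) μ := h0.integrable_sq.div_const 2
  -- Pathwise energy balance, with the terminal energy `f t ω ^ 2 / 2` dropped.
  have hkey : ∀ᵐ ω ∂μ, ∫⁻ s in Set.Ioc 0 t, ENNReal.ofReal (f s ω * g (f s ω)) =
        ENNReal.ofReal (∫ s in Set.Ioc 0 t, f s ω * g (f s ω)) ∧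
      ∫ s in Set.Ioc 0 t, f s ω * g (f s ω)
        ≤ f 0 ω ^ 2 / 2 - ∫ s in Set.Ioc 0 t, f s ω * w s ω := by
    filter_upwards [htraj, hwae] with ω h1 h2
    have hc := h1.continuousOn_Icc t
    have hfm : Measurable fun s => f s ω := hf.comp measurable_prodMk_right
    have hwm : Measurable fun s => w s ω := hw.comp measurable_prodMk_right
    have hi1 : IntegrableOn (fun s => f s ω * g (f s ω)) (Set.Ioc 0 t) := by
      have : IntegrableOn (fun s => f s ω ^ 2) (Set.Ioc 0 t) :=
        ((hc.pow 2).integrableOn_Icc).mono_set Set.Ioc_subset_Icc_self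
      refine this.mono' (hfm.mul (hg.comp hfm)).aestronglyMeasurable ?_
      refine Eventually.of_forall fun s => ?_
      rw [Real.norm_eq_abs, abs_mul, ← sq_abs, sq]
      exact mul_le_mul_of_nonneg_left (hgl _) (abs_nonneg _)
    have hi2 : IntegrableOn (fun s => f s ω * w s ω) (Set.Ioc 0 t) := by
      have : IntegrableOn (fun s => |f s ω| * K) (Set.Ioc 0 t) :=
        ((hc.abs.mul continuousOn_const).integrableOn_Icc).mono_set Set.Ioc_subset_Icc_self
      refine this.mono' (hfm.mul hwm).aestronglyMeasurable ?_
      rw [ae_restrict_iff' measurableSet_Ioc]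
      filter_upwards [h2] with s hs hst
      rw [Real.norm_eq_abs, abs_mul]
      exact mul_le_mul_of_nonneg_left (hs hst.1.le) (abs_nonneg _)
    refine ⟨(ofReal_integral_eq_lintegral_ofReal hi1
      (Eventually.of_forall fun s => hgn _)).symm, ?_⟩
    have hen := h1.sq_eq ht
    rw [intervalIntegral.integral_of_le ht] at hen
    have e : ∫ s in Set.Ioc 0 t, f s ω * (-g (f s ω) - w s ω)
        = -(∫ s in Set.Ioc 0 t, f s ω * g (f s ω)) - ∫ s in Set.Ioc 0 t, f s ω * w s ω := by
      rw [← integral_neg, ← integral_sub hi1.fun_neg hi2]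
      exact integral_congr_ae (Eventually.of_forall fun s => by ring)
    rw [e] at hen
    nlinarith [sq_nonneg (f t ω)]
  calc ∫⁻ ω, (∫⁻ s in Set.Ioc 0 t, ENNReal.ofReal (f s ω * g (f s ω))) ∂μ
      ≤ ∫⁻ ω, ENNReal.ofReal (f 0 ω ^ 2 / 2 - ∫ s in Set.Ioc 0 t, f s ω * w s ω) ∂μ := by
        refine lintegral_mono_ae ?_
        filter_upwards [hkey] with ω h
        rw [h.1]
        exact ENNReal.ofReal_le_ofReal h.2
    _ = ENNReal.ofReal (∫ ω, (f 0 ω ^ 2 / 2 - ∫ s in Set.Ioc 0 t, f s ω * w s ω) ∂μ) := by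
        -- The integrand is nonnegative because it dominates the dissipation.
        refine (ofReal_integral_eq_lintegral_ofReal (hsq.sub hJ) ?_).symm
        filter_upwards [hkey] with ω h
        exact (integral_nonneg fun s => hgn _).trans h.2
    _ = ENNReal.ofReal (∫ ω, f 0 ω ^ 2 / 2 ∂μ) := by
        rw [integral_sub hsq hJ, hJ0, sub_zero]

/-- A state driven by a bounded disturbance that is uncorrelated with it, under a coercive
sign-preserving negative feedback, vanishes at infinity almost surely. -/
theorem ae_tendsto_zero_of_uncorrelated (hf : Measurable (Function.uncurry f))
    (hw : Measurable (Function.uncurry w)) (hg : Measurable g) (hK : 0 ≤ K)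
    (hgn : ∀ x, 0 ≤ x * g x) (hgl : ∀ x, |g x| ≤ |x|)
    (hgc : ∀ δ > 0, ∃ η > 0, ∀ x, δ ≤ |x| → η ≤ x * g x)
    (htraj : ∀ᵐ ω ∂μ, IsPrimitive (fun t => -g (f t ω) - w t ω) (fun t => f t ω))
    (hwK : ∀ t, 0 ≤ t → ∀ᵐ ω ∂μ, |w t ω| ≤ K) (h0 : MemLp (f 0) 2 μ)
    (hcorr : ∀ t, 0 ≤ t → ∫ ω, f t ω * w t ω ∂μ = 0) :
    ∀ᵐ ω ∂μ, Tendsto (fun t => f t ω) atTop (𝓝 0) := by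
  have hm : Measurable fun p : Ω × ℝ => ENNReal.ofReal (f p.2 p.1 * g (f p.2 p.1)) :=
    ((hf.mul (hg.comp hf)).comp measurable_swap).ennreal_ofReal
  have hU : ⋃ N : ℕ, Set.Ioc (0 : ℝ) N = Set.Ioi 0 := by
    ext s
    simp only [Set.mem_iUnion, Set.mem_Ioc, Set.mem_Ioi]
    exact ⟨fun ⟨_, h⟩ => h.1, fun h => (exists_nat_ge s).imp fun N hN => ⟨h, hN⟩⟩
  have hmono : Monotone fun N : ℕ => Set.Ioc (0 : ℝ) N := fun a b hab =>
    Set.Ioc_subset_Ioc_right (by exact_mod_cast hab)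
  have hsup : ∀ ω, ∫⁻ s in Set.Ioi 0, ENNReal.ofReal (f s ω * g (f s ω))
      = ⨆ N : ℕ, ∫⁻ s in Set.Ioc (0 : ℝ) N, ENNReal.ofReal (f s ω * g (f s ω)) := fun ω => by
    rw [← hU, setLIntegral_iUnion_of_directed _ hmono.directed_le]
  have hfin : ∫⁻ ω, (∫⁻ s in Set.Ioi 0, ENNReal.ofReal (f s ω * g (f s ω))) ∂μ ≠ ⊤ := by
    simp_rw [hsup]
    -- The energy bound does not depend on `N`, so it survives monotone convergence.
    rw [lintegral_iSup (fun N => hm.lintegral_prod_right') fun a b hab ω =>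
      lintegral_mono_set (hmono hab)]
    exact ((iSup_le fun N => lintegral_dissipation_le hf hw hg hK hgn hgl htraj hwK h0 hcorr
      N.cast_nonneg).trans_lt ENNReal.ofReal_lt_top).ne
  filter_upwards [ae_lt_top hm.lintegral_prod_right' hfin,
    ae_abs_le_abs_add hw hK hgn htraj hwK] with ω h1 h2
  refine tendsto_zero_of_integrableOn_of_abs_le_add (ψ := fun x => x * g x) hK h2 hgc ?_
  have hfm : Measurable fun s => f s ω := hf.comp measurable_prodMk_right
  exact (lintegral_ofReal_ne_top_iff_integrable (hfm.mul (hg.comp hfm)).aestronglyMeasurable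
    (Eventually.of_forall fun s => hgn _)).mp h1.ne

end Dissipation

/-! ### Linear combinations of indefinite integrals -/

namespace IsPrimitive

theorem congr_of_nonneg {h h' X X' : ℝ → ℝ} (hX : IsPrimitive h X) (hh : ∀ t, 0 ≤ t → h t = h' t)
    (hXX : ∀ t, 0 ≤ t → X t = X' t) : IsPrimitive h' X' := fun t ht => by
  have hcongr : Set.EqOn h h' (Set.uIcc 0 t) := fun s hs => by
    rw [Set.uIcc_of_le ht] at hs
    exact hh s hs.1
  refine ⟨(hX t ht).1.congr fun s hs => hcongr (Set.uIoc_subset_uIcc hs), ?_⟩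
  rw [← hXX t ht, ← hXX 0 le_rfl, (hX t ht).2, intervalIntegral.integral_congr hcongr]

theorem add {h k X Y : ℝ → ℝ} (hX : IsPrimitive h X) (hY : IsPrimitive k Y) :
    IsPrimitive (fun t => h t + k t) (fun t => X t + Y t) := fun t ht => by
  refine ⟨(hX t ht).1.add (hY t ht).1, ?_⟩
  have hX' := (hX t ht).2
  have hY' := (hY t ht).2
  simp only [intervalIntegral.integral_add (hX t ht).1 (hY t ht).1]
  linarith

theorem const_mul {h X : ℝ → ℝ} (hX : IsPrimitive h X) (c : ℝ) :
    IsPrimitive (fun t => c * h t) (fun t => c * X t) := fun t ht => by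
  refine ⟨(hX t ht).1.const_mul c, ?_⟩
  have hX' := (hX t ht).2
  simp only [intervalIntegral.integral_const_mul]
  rw [hX', mul_add]

theorem sum {ι : Type*} (s : Finset ι) {h X : ι → ℝ → ℝ} (hX : ∀ i, IsPrimitive (h i) (X i)) :
    IsPrimitive (fun t => ∑ i ∈ s, h i t) (fun t => ∑ i ∈ s, X i t) := by
  classical
  induction s using Finset.induction_on with
  | empty => intro t _; simp
  | insert a s ha ih => simpa only [Finset.sum_insert ha] using (hX a).add ih

end IsPrimitive

/-! ### Saturation, matrix inversion and the disturbance bound -/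

namespace DynamicTU

theorem IsTrajectory.eval {ι : Type*} [Fintype ι] {h X : ℝ → ι → ℝ} (hX : IsTrajectory h X)
    (i : ι) : IsPrimitive (fun t => h t i) (fun t => X t i) := fun t ht => by
  obtain ⟨h1, h2⟩ := hX t ht
  rw [intervalIntegrable_iff_integrableOn_Ioc_of_le ht] at h1
  refine ⟨(intervalIntegrable_iff_integrableOn_Ioc_of_le ht).mpr (Integrable.eval h1 i), ?_⟩
  rw [intervalIntegral.integral_of_le ht] at h2 ⊢
  rw [← eval_integral fun i => Integrable.eval h1 i]
  exact congrFun h2 i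

theorem IsTrajectory.mulVec_eval {ι κ : Type*} [Fintype ι] {h X : ℝ → ι → ℝ}
    (hX : IsTrajectory h X) (M : Matrix κ ι ℝ) (j : κ) :
    IsPrimitive (fun t => M.mulVec (h t) j) (fun t => M.mulVec (X t) j) :=
  IsPrimitive.sum Finset.univ fun i => (hX.eval i).const_mul (M j i)

open scoped Classical in
/-- The scalar saturation of `ξ` between `a` and `b`. -/
noncomputable def clip (a b : EReal) (ξ : ℝ) : ℝ :=
  if b < (ξ : EReal) then b.toReal else if (ξ : EReal) < a then a.toReal else ξ

theorem sat_apply {ι : Type*} (a b : ι → EReal) (ξ : ι → ℝ) (i : ι) :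
    sat a b ξ i = clip (a i) (b i) (ξ i) := rfl

theorem measurable_clip (a b : EReal) : Measurable (clip a b) := by
  unfold clip
  exact Measurable.ite (measurableSet_lt measurable_const measurable_coe_real_ereal)
    measurable_const (Measurable.ite (measurableSet_lt measurable_coe_real_ereal measurable_const)
      measurable_const measurable_id)

/-- Saturation between bounds of opposite signs preserves the sign, does not increase the absolute
value, and truncates only absolute values above a positive threshold. -/
theorem exists_clip_bounds {a b : EReal} (ha : a < 0) (hb : 0 < b) :
    ∃ ε > 0, ∀ ξ : ℝ, 0 ≤ ξ * clip a b ξ ∧ |clip a b ξ| ≤ |ξ| ∧ min |ξ| ε ≤ |clip a b ξ| := by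
  -- Real numbers strictly between zero and each bound give a threshold even when a bound is
  -- infinite.
  obtain ⟨r, hr0, hrb⟩ := EReal.lt_iff_exists_real_btwn.mp hb
  obtain ⟨q, hqa, hq0⟩ := EReal.lt_iff_exists_real_btwn.mp ha
  have hr0' : 0 < r := by exact_mod_cast hr0
  have hq0' : q < 0 := by exact_mod_cast hq0
  refine ⟨min r (-q), lt_min hr0' (by linarith), fun ξ => ?_⟩
  unfold clip
  split_ifs with h1 h2
  · lift b to ℝ using ⟨h1.ne_top, (EReal.bot_lt_zero.trans hb).ne'⟩
    norm_cast at h1 hrb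
    rw [EReal.toReal_coe, abs_of_pos (hr0'.trans hrb), abs_of_pos (hr0'.trans (hrb.trans h1))]
    exact ⟨by nlinarith, h1.le, (min_le_right _ _).trans ((min_le_left _ _).trans hrb.le)⟩
  · lift a to ℝ using ⟨(ha.trans (EReal.coe_lt_top 0)).ne, h2.ne_bot⟩
    norm_cast at h2 hqa
    rw [EReal.toReal_coe, abs_of_neg (hqa.trans hq0'), abs_of_neg (h2.trans (hqa.trans hq0'))]
    exact ⟨by nlinarith, by linarith,
      (min_le_right _ _).trans ((min_le_right _ _).trans (by linarith))⟩
  · exact ⟨mul_self_nonneg ξ, le_rfl, min_le_left _ _⟩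

/-- Both sides count `n + m - 1`, so the stacked matrix of `B` and `C` is square. -/
theorem card_control (n : ℕ) [NeZero n] :
    Fintype.card (ControlIdx n) = Fintype.card (Coalition n ⊕ Fin (n - 1)) := by
  have h1 : Fintype.card (ProperCoalition n) = Fintype.card (Coalition n) - 1 := by
    rw [← Fintype.card_subtype_eq (grand n), ← Fintype.card_subtype_compl]
    exact Fintype.card_congr (Equiv.subtypeEquivRight fun S => by simp [grand, Subtype.ext_iff])
  have h2 : 0 < Fintype.card (Coalition n) := Fintype.card_pos_iff.mpr ⟨grand n⟩
  have h3 := NeZero.pos n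
  rw [Fintype.card_sum, Fintype.card_sum, h1, Fintype.card_fin, Fintype.card_fin]
  omega

section Augmented

variable {n : ℕ} {Bd : Matrix (ControlIdx n) (Coalition n) ℝ}
  {C : Matrix (Fin (n - 1)) (ControlIdx n) ℝ} {F : Matrix (ControlIdx n) (Fin (n - 1)) ℝ}

/-- Recovers `x` and `y` from `z`, so that integrability of `z` passes to both. -/
theorem mulVec_augmented (hBC : Matrix.fromRows (flowMatrix n) C * Matrix.fromCols Bd F = 1)
    (x : Coalition n → ℝ) (y : Fin (n - 1) → ℝ) :
    (flowMatrix n).mulVec (augmented Bd F x y) = x ∧ C.mulVec (augmented Bd F x y) = y := by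
  have h : (Matrix.fromRows (flowMatrix n) C).mulVec (augmented Bd F x y) = Sum.elim x y := by
    rw [augmented, Matrix.mulVec_mulVec, hBC, Matrix.one_mulVec]
  rw [Matrix.fromRows_mulVec] at h
  exact ⟨funext fun k => congrFun h (Sum.inl k), funext fun k => congrFun h (Sum.inr k)⟩

/-- A one-sided inverse of a square matrix is two-sided. This identity removes the coupling between
the components of `z`. -/
theorem augmented_mulVec [NeZero n]
    (hBC : Matrix.fromRows (flowMatrix n) C * Matrix.fromCols Bd F = 1)
    (d : ControlIdx n → ℝ) :
    Bd.mulVec ((flowMatrix n).mulVec d) + F.mulVec (C.mulVec d) = d := by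
  have h := (Matrix.fromCols_mul_fromRows_eq_one_comm
    (Fintype.equivOfCardEq (card_control n)) Bd F (flowMatrix n) C).mpr hBC
  rw [Matrix.fromCols_mul_fromRows] at h
  rw [Matrix.mulVec_mulVec, Matrix.mulVec_mulVec, ← Matrix.add_mulVec, h, Matrix.one_mulVec]

end Augmented

theorem IsBoundedMeanErgodic.exists_bound {ι Ω : Type*} [Fintype ι] [MeasurableSpace Ω]
    {μ : Measure Ω} {𝒱 : Set (ι → ℝ)} {P : Measure (ι → ℝ)} {v : ℝ → Ω → ι → ℝ} {vNom : ι → ℝ}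
    (hv : IsBoundedMeanErgodic μ 𝒱 P v vNom) :
    ∃ R, 0 ≤ R ∧ ∀ t, 0 ≤ t → ∀ᵐ ω ∂μ, ∀ i, |v t ω i - vNom i| ≤ R := by
  obtain ⟨R, hR⟩ := hv.bounded.subset_closedBall 0
  refine ⟨max R 0 + ‖vNom‖, by positivity, fun t ht => ?_⟩
  have hm : Measurable (v t) := hv.measurable.comp measurable_prodMk_left
  have := hv.mem
  rw [← hv.law t ht] at this
  filter_upwards [ae_of_ae_map hm.aemeasurable this] with ω hω i
  have h1 : ‖v t ω‖ ≤ R := mem_closedBall_zero_iff.mp (hR hω)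
  calc |v t ω i - vNom i| ≤ |v t ω i| + |vNom i| := abs_sub _ _
    _ ≤ ‖v t ω‖ + ‖vNom‖ := add_le_add (norm_le_pi_norm (v t ω) i) (norm_le_pi_norm vNom i)
    _ ≤ max R 0 + ‖vNom‖ := by gcongr; exact h1.trans (le_max_left _ _)

end DynamicTU

/-! ### Passing to a jointly measurable modification -/

/-- Variant of `ae_tendsto_zero_of_uncorrelated` that asks for measurability of the state at fixed
times only: almost sure path continuity provides a jointly measurable modification. -/
theorem ae_tendsto_zero_of_uncorrelated_of_forall_measurable {Ω : Type*} [MeasurableSpace Ω]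
    {μ : Measure Ω} [IsProbabilityMeasure μ] {f w : ℝ → Ω → ℝ} {g : ℝ → ℝ} {K : ℝ}
    (hf : ∀ t, 0 ≤ t → Measurable (f t))
    (hw : Measurable (Function.uncurry w)) (hg : Measurable g) (hK : 0 ≤ K)
    (hgn : ∀ x, 0 ≤ x * g x) (hgl : ∀ x, |g x| ≤ |x|)
    (hgc : ∀ δ > 0, ∃ η > 0, ∀ x, δ ≤ |x| → η ≤ x * g x)
    (htraj : ∀ᵐ ω ∂μ, IsPrimitive (fun t => -g (f t ω) - w t ω) (fun t => f t ω))
    (hwK : ∀ t, 0 ≤ t → ∀ᵐ ω ∂μ, |w t ω| ≤ K) (h0 : MemLp (f 0) 2 μ)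
    (hcorr : ∀ t, 0 ≤ t → ∫ ω, f t ω * w t ω ∂μ = 0) :
    ∀ᵐ ω ∂μ, Tendsto (fun t => f t ω) atTop (𝓝 0) := by
  obtain ⟨G, hG, hGm, hGtraj⟩ := htraj.exists_measurable_mem
  -- Frozen before time zero and set to zero off the full-measure set `G`, every path of `f'` is
  -- continuous.
  let f' : ℝ → Ω → ℝ := fun t => G.indicator (f (max t 0))
  have hf'_of_mem : ∀ ω ∈ G, ∀ t, f' t ω = f (max t 0) ω := fun ω hω t =>
    Set.indicator_of_mem hω _
  have hae : ∀ t, 0 ≤ t → f' t =ᵐ[μ] f t := fun t ht => by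
    filter_upwards [hG] with ω hω
    rw [hf'_of_mem ω hω, max_eq_left ht]
  have hf' : Measurable (Function.uncurry f') := by
    refine measurable_uncurry_of_continuous_of_measurable (fun ω => ?_) fun t =>
      (hf _ (le_max_right t 0)).indicator hGm
    by_cases hω : ω ∈ G
    · simpa only [hf'_of_mem ω hω] using (hGtraj ω hω).continuous_comp_max
    · simpa only [f', Set.indicator_of_notMem hω] using continuous_const
  have hmain := ae_tendsto_zero_of_uncorrelated hf' hw hg hK hgn hgl hgc
    (by
      filter_upwards [hG] with ω hω
      refine (hGtraj ω hω).congr_of_nonneg (fun t ht => ?_) fun t ht => ?_ <;>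
      simp only [hf'_of_mem ω hω, max_eq_left ht])
    hwK (h0.ae_eq (hae 0 le_rfl).symm) (fun t ht => by
      rw [← hcorr t ht]
      exact integral_congr_ae ((hae t ht).mono fun ω h => by simp only [h]))
  filter_upwards [hmain, hG] with ω h1 hω
  refine h1.congr' ?_
  filter_upwards [eventually_ge_atTop 0] with t ht
  rw [hf'_of_mem ω hω, max_eq_left ht]

/-! ### Moments of linear images -/

namespace DynamicTU

theorem memLp_mulVec_eval {Ω ι κ : Type*} [MeasurableSpace Ω] [Fintype ι] {μ : Measure Ω}
    {X : Ω → ι → ℝ} {p : ENNReal} (hX : ∀ i, MemLp (fun ω => X ω i) p μ)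
    (M : Matrix κ ι ℝ) (j : κ) : MemLp (fun ω => M.mulVec (X ω) j) p μ :=
  memLp_finsetSum Finset.univ fun i _ => (hX i).const_mul (M j i)

theorem measurable_mulVec_eval {ι κ : Type*} [Fintype ι] (M : Matrix κ ι ℝ) (j : κ) :
    Measurable fun X : ι → ℝ => M.mulVec X j :=
  Finset.measurable_sum _ fun i _ => measurable_const.mul (measurable_pi_apply i)

theorem IsBoundedMeanErgodic.integral_mulVec_eq_zero {ι κ Ω : Type*} [Fintype ι]
    [MeasurableSpace Ω] {μ : Measure Ω} [IsProbabilityMeasure μ] {𝒱 : Set (ι → ℝ)}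
    {P : Measure (ι → ℝ)} {v : ℝ → Ω → ι → ℝ} {vNom : ι → ℝ}
    (hv : IsBoundedMeanErgodic μ 𝒱 P v vNom) (M : Matrix κ ι ℝ) (j : κ) {t : ℝ} (ht : 0 ≤ t) :
    Integrable (fun ω => M.mulVec (v t ω - vNom) j) μ ∧
      ∫ ω, M.mulVec (v t ω - vNom) j ∂μ = 0 := by
  obtain ⟨R, hR, hb⟩ := hv.exists_bound
  have hm : Measurable (v t) := hv.measurable.comp measurable_prodMk_left
  have hd : ∀ i, Integrable (fun ω => v t ω i - vNom i) μ := fun i => by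
    refine (integrable_const R).mono'
      (((measurable_pi_apply i).comp hm).sub_const _).aestronglyMeasurable ?_
    filter_upwards [hb t ht] with ω h using h i
  have hi : ∀ i, Integrable (fun ω => v t ω i) μ := fun i =>
    ((hd i).add (integrable_const (vNom i))).congr
      (Eventually.of_forall fun ω => sub_add_cancel (v t ω i) (vNom i))
  refine ⟨integrable_finsetSum _ fun i _ => (hd i).const_mul (M j i), ?_⟩
  change ∫ ω, ∑ i, M j i * (v t ω i - vNom i) ∂μ = 0
  rw [integral_finsetSum _ fun i _ => (hd i).const_mul (M j i)]
  refine Finset.sum_eq_zero fun i _ => ?_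
  rw [integral_const_mul, integral_sub (hi i) (integrable_const _), ← eval_integral hi,
    hv.mean t ht]
  simp

end DynamicTU

/-! ### The closed loop -/

theorem theorem1 {n : ℕ} [NeZero n] {Ω : Type*} [MeasurableSpace Ω]
    (μ : Measure Ω) [IsProbabilityMeasure μ]
    -- the bounded mean ergodic flow of characteristic functions
    (𝒱 : Set (Coalition n → ℝ)) (P : Measure (Coalition n → ℝ))
    (v : ℝ → Ω → Coalition n → ℝ) (vNom : Coalition n → ℝ)
    (hv : IsBoundedMeanErgodic μ 𝒱 P v vNom)
    -- allocation bounds, nominal allocation in the core, nominal control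
    (aMin aMax aNom : Fin n → ℝ) (haNom : aNom ∈ core vNom)
    (U : Set (ControlIdx n → ℝ)) (hU : U = feasibleControls aMin aMax)
    (uNom : ControlIdx n → ℝ) (huNom : uNom = nominalControl aNom vNom)
    -- the control may move in both directions in every component
    (hΔ : ∀ j, deltaMin U uNom j < 0 ∧ 0 < deltaMax U uNom j)
    -- a pseudo-inverse of `B` and completing matrices
    (Bd : Matrix (ControlIdx n) (Coalition n) ℝ)
    (C : Matrix (Fin (n - 1)) (ControlIdx n) ℝ) (F : Matrix (ControlIdx n) (Fin (n - 1)) ℝ)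
    (hBC : Matrix.fromRows (flowMatrix n) C * Matrix.fromCols Bd F = 1)
    -- the state `x`, the augmenting state `y`, the variable `z`, the control `u`
    (x : ℝ → Ω → Coalition n → ℝ) (y : ℝ → Ω → Fin (n - 1) → ℝ)
    (z u : ℝ → Ω → ControlIdx n → ℝ)
    (hz : ∀ t ω, z t ω = augmented Bd F (x t ω) (y t ω))
    (hu : ∀ t ω, u t ω = feedback U uNom (z t ω))
    (hxm : ∀ t, 0 ≤ t → Measurable (x t)) (hym : ∀ t, 0 ≤ t → Measurable (y t))
    (hx0 : MemLp (x 0) 2 μ) (hy0 : MemLp (y 0) 2 μ)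
    -- independence of the current fluctuation from the current states
    (hxv : ∀ t, 0 ≤ t → IndepFun (x t) (fun ω => v t ω - vNom) μ)
    (hyv : ∀ t, 0 ≤ t → IndepFun (y t) (v t) μ)
    -- the closed-loop dynamics
    (hx : ∀ᵐ ω ∂μ, IsTrajectory
      (fun t => (flowMatrix n).mulVec (u t ω - uNom) - (v t ω - vNom)) (fun t => x t ω))
    (hy : ∀ᵐ ω ∂μ, IsTrajectory (fun t => C.mulVec (u t ω - uNom)) (fun t => y t ω)) :
    (∀ᵐ ω ∂μ, Tendsto (fun t => z t ω) atTop (𝓝 0)) ∧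
    (∀ᵐ ω ∂μ, Tendsto (timeAverage fun t => u t ω) atTop (𝓝 uNom)) := by
  obtain ⟨R, hR, hvR⟩ := hv.exists_bound
  let g : ControlIdx n → ℝ → ℝ := fun j ξ => -clip (deltaMin U uNom j) (deltaMax U uNom j) (-ξ)
  let w : ControlIdx n → ℝ → Ω → ℝ := fun j t ω => Bd.mulVec (v t ω - vNom) j
  have hug : ∀ t ω j, u t ω j - uNom j = -g j (z t ω j) := fun t ω j => by
    simp only [hu, feedback, Pi.add_apply, sat_apply, g, Pi.neg_apply]
    ring
  have hgm : ∀ j, Measurable (g j) := fun j => ((measurable_clip _ _).comp measurable_neg).neg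
  have hgb : ∀ j, (∀ ξ, 0 ≤ ξ * g j ξ) ∧ (∀ ξ, |g j ξ| ≤ |ξ|) ∧
      ∀ δ > 0, ∃ η > 0, ∀ ξ, δ ≤ |ξ| → η ≤ ξ * g j ξ := by
    intro j
    obtain ⟨ε, hε, hclip⟩ := exists_clip_bounds (hΔ j).1 (hΔ j).2
    have hnn : ∀ ξ, 0 ≤ ξ * g j ξ := fun ξ => by
      have := (hclip (-ξ)).1
      simp only [g]
      linarith
    -- If `|ξ| ≥ δ` then `|g j ξ| ≥ min δ ε`, whence the product `δ * min δ ε`.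
    refine ⟨hnn, fun ξ => ?_, fun δ hδ => ⟨δ * min δ ε, by positivity, fun ξ hξ => ?_⟩⟩
    · simpa only [g, abs_neg] using (hclip (-ξ)).2.1
    · rw [← abs_of_nonneg (hnn ξ), abs_mul]
      have h := (hclip (-ξ)).2.2
      rw [abs_neg] at h
      simp only [g, abs_neg]
      exact mul_le_mul hξ ((min_le_min_right ε hξ).trans h) (by positivity) (abs_nonneg _)
  have hz' : ∀ t ω j, z t ω j = Bd.mulVec (x t ω) j + F.mulVec (y t ω) j := fun t ω j => by
    rw [hz, augmented, Matrix.fromCols_mulVec_sumElim, Pi.add_apply]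
  have hzm : ∀ j t, 0 ≤ t → Measurable (fun ω => z t ω j) := fun j t ht => by
    simp only [hz']
    exact ((measurable_mulVec_eval Bd j).comp (hxm t ht)).add
      ((measurable_mulVec_eval F j).comp (hym t ht))
  have hwm : ∀ j, Measurable (Function.uncurry (w j)) := fun j =>
    (measurable_mulVec_eval Bd j).comp (hv.measurable.sub_const vNom)
  have hztraj : ∀ j, ∀ᵐ ω ∂μ,
      IsPrimitive (fun t => -g j (z t ω j) - w j t ω) (fun t => z t ω j) := fun j => by
    filter_upwards [hx, hy] with ω hxω hyω
    refine ((hxω.mulVec_eval Bd j).add (hyω.mulVec_eval F j)).congr_of_nonneg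
      (fun t _ => ?_) fun t _ => (hz' t ω j).symm
    have h := congrFun (augmented_mulVec hBC (u t ω - uNom)) j
    rw [Pi.add_apply, Pi.sub_apply, hug] at h
    rw [Matrix.mulVec_sub, Pi.sub_apply, ← h]
    simp only [w]
    ring
  let K : ControlIdx n → ℝ := fun j => ∑ k, |Bd j k| * R
  have hK : ∀ j, 0 ≤ K j := fun j => Finset.sum_nonneg fun k _ => by positivity
  have hwK : ∀ j t, 0 ≤ t → ∀ᵐ ω ∂μ, |w j t ω| ≤ K j := fun j t ht => by
    filter_upwards [hvR t ht] with ω h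
    refine (Finset.abs_sum_le_sum_abs (fun k => Bd j k * (v t ω k - vNom k)) Finset.univ).trans
      (Finset.sum_le_sum fun k _ => ?_)
    rw [abs_mul]
    exact mul_le_mul_of_nonneg_left (h k) (abs_nonneg _)
  have hz0 : ∀ j, MemLp (fun ω => z 0 ω j) 2 μ := fun j => by
    simp only [hz']
    exact (memLp_mulVec_eval (memLp_pi_iff.mp hx0) Bd j).add
      (memLp_mulVec_eval (memLp_pi_iff.mp hy0) F j)
  -- The growth bound carries integrability from time zero to time `t`.
  have hzi : ∀ t, 0 ≤ t → ∀ j, MemLp (fun ω => z t ω j) 1 μ := fun t ht j => by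
    rw [memLp_one_iff_integrable]
    refine integrable_of_ae_abs_le_add (c := K j * (t - 0)) (hzm j t ht).aestronglyMeasurable
      ((hz0 j).integrable (by norm_num)) ?_
    filter_upwards [ae_abs_le_abs_add (f := fun t ω => z t ω j) (hwm j) (hK j) (hgb j).1
      (hztraj j) (hwK j)] with ω h using h 0 t le_rfl ht
  -- The independence assumptions concern `x` and `y` separately, not the pair, so `z_j w_j` is
  -- split into its `x` and `y` parts. Each has mean zero because `w_j` does.
  have hcorr : ∀ j t, 0 ≤ t → ∫ ω, z t ω j * w j t ω ∂μ = 0 := fun j t ht => by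
    have hxz : ∀ ω, (flowMatrix n).mulVec (z t ω) = x t ω := fun ω => by
      rw [hz]; exact (mulVec_augmented hBC _ _).1
    have hyz : ∀ ω, C.mulVec (z t ω) = y t ω := fun ω => by
      rw [hz]; exact (mulVec_augmented hBC _ _).2
    have hxi : Integrable (fun ω => Bd.mulVec (x t ω) j) μ := by
      simp only [← hxz]
      exact memLp_one_iff_integrable.mp
        (memLp_mulVec_eval (fun k => memLp_mulVec_eval (hzi t ht) _ k) Bd j)
    have hyi : Integrable (fun ω => F.mulVec (y t ω) j) μ := by
      simp only [← hyz]
      exact memLp_one_iff_integrable.mp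
        (memLp_mulVec_eval (fun k => memLp_mulVec_eval (hzi t ht) _ k) F j)
    obtain ⟨hwi, hw0⟩ := hv.integral_mulVec_eq_zero Bd j ht
    have hxw : IndepFun (fun ω => Bd.mulVec (x t ω) j) (w j t) μ :=
      (hxv t ht).comp (measurable_mulVec_eval Bd j) (measurable_mulVec_eval Bd j)
    have hyw : IndepFun (fun ω => F.mulVec (y t ω) j) (w j t) μ :=
      (hyv t ht).comp (measurable_mulVec_eval F j)
        ((measurable_mulVec_eval Bd j).comp (measurable_id.sub_const vNom))
    simp only [hz', add_mul]
    have hxwi : Integrable (fun ω => Bd.mulVec (x t ω) j * w j t ω) μ := hxw.integrable_mul hxi hwi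
    have hywi : Integrable (fun ω => F.mulVec (y t ω) j * w j t ω) μ := hyw.integrable_mul hyi hwi
    rw [integral_add hxwi hywi, hxw.integral_fun_mul_eq_mul_integral hxi.1 hwi.1,
      hyw.integral_fun_mul_eq_mul_integral hyi.1 hwi.1]
    simp only [w, hw0, mul_zero, add_zero]
  have hlim : ∀ᵐ ω ∂μ, ∀ j, Tendsto (fun t => z t ω j) atTop (𝓝 0) := ae_all_iff.mpr fun j =>
    ae_tendsto_zero_of_uncorrelated_of_forall_measurable (f := fun t ω => z t ω j) (hzm j) (hwm j)
      (hgm j) (hK j) (hgb j).1 (hgb j).2.1 (hgb j).2.2 (hztraj j) (hwK j) (hz0 j) (hcorr j)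
  refine ⟨hlim.mono fun ω h => tendsto_pi_nhds.mpr h, ?_⟩
  filter_upwards [hlim, ae_all_iff.mpr hztraj] with ω hω htraj
  have hueq : ∀ t j, u t ω j = uNom j + -g j (z t ω j) := fun t j => by
    rw [← hug]; ring
  refine tendsto_inv_smul_integral (fun t ht => ?_) (tendsto_pi_nhds.mpr fun j => ?_)
  · rw [intervalIntegrable_iff_integrableOn_Ioc_of_le ht]
    refine Integrable.of_eval fun j => ?_
    simp only [hueq]
    have hc := ((htraj j).continuousOn_Icc t).mono Set.Ioc_subset_Icc_self
    have hzint : IntegrableOn (fun s => z s ω j) (Set.Ioc 0 t) :=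
      ((htraj j).continuousOn_Icc t).integrableOn_Icc.mono_set Set.Ioc_subset_Icc_self
    refine (integrable_const _).add (Integrable.neg (hzint.abs.mono' ?_ ?_))
    · exact ((hgm j).comp_aemeasurable hzint.1.aemeasurable).aestronglyMeasurable
    · exact Eventually.of_forall fun s => (hgb j).2.1 _
  -- Since `|g j ξ| ≤ |ξ|`, the control deviation vanishes with `z`.
  · have h0 : Tendsto (fun t => g j (z t ω j)) atTop (𝓝 0) :=
      squeeze_zero_norm (fun t => (hgb j).2.1 _) (by simpa using (hω j).abs)
    simpa [hueq] using h0.neg.const_add (uNom j)
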